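/- Let $E/F$ be a field extension with $|E:F|=2$. Let $M=\bigoplus_{i\ge 1}M_i$ be a graded Lie algebra of maximal class over $E$ generated in degree $1$, that is, a Lie algebra graded over the positive integers with $\dim_E M_1=2$, $\dim_E M_i=1$ for $i\ge 2$, and $[M_i,M_1]=M_{i+1}$ for $i\ge 1$. For $i\ge 2$ let $C_i=\{a\in M_1 : [a,M_i]=0\}$ be its two-step centralisers. Let $X,Y\in M_1$ be $E$-linearly independent, let $L$ be the Lie $F$-subalgebra of $M$ generated by $X$ and $Y$, graded by $L_i=L\cap M_i$, and set $d_i=\dim_F(C_i\cap L_1)$ for $i\ge 2$. For a positive integer $r$, a graded Lie algebra $L=\bigoplus_{i\ge1}L_i$ generated by $L_1$ is called *ideally $r$-constrained* if for every nonzero graded ideal $I$ of $L$ there is a positive integer $i$ with $L^i\supseteq I\supseteq L^{i+r}$, where $L^1=L$ and $L^{i+1}=[L^i,L]$. **Proposition.** Assume that the sequence $(d_i)_{i\ge 2}$ is not constant. Then the set $D_0=\{i\ge 2 : d_i=0\}$ is infinite. Let $t_1<t_2<\cdots$ be its elements. Then $t_j-t_{j-1}\le t_1$ for every $j\ge 2$.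 If $r=\max_{j\ge 2}(t_j-t_{j-1})$, then $2\le r\le t_1$, and $L$ is ideally $r$-constrained but not ideally $(r-1)$-constrained. Moreover $\dim_F L_i=1$ if $2\le i\le t_1$, and $\dim_F L_i=2$ for all other $i\ge 1$. -/

import Mathlib

namespace ThinLie

section Graded

variable (R : Type*) {L : Type*} [CommRing R] [LieRing L] [LieAlgebra R L]

/-- `𝓛` is a grading of the Lie algebra `L` over the positive integers: `L` is the internal direct
sum of the submodules `𝓛 i`, `i ≥ 1` (index `0` is forced to be trivial), and
`[𝓛 i, 𝓛 j] ⊆ 𝓛 (i + j)`. -/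
structure IsLieGrading (𝓛 : ℕ → Submodule R L) : Prop where
  isInternal : DirectSum.IsInternal 𝓛
  zero_eq_bot : 𝓛 0 = ⊥
  gradedBracket : SetLike.GradedBracket 𝓛

/-- A (graded) Lie algebra of maximal class generated in degree `1`: the component of degree `1`
has dimension `2`, all the others have dimension `1`, and `[𝓛 i, 𝓛 1] = 𝓛 (i + 1)` for `i ≥ 1`. -/
structure IsMaximalClass (𝓛 : ℕ → Submodule R L) : Prop extends IsLieGrading R 𝓛 where
  finrank_one : Module.finrank R (𝓛 1) = 2
  finrank_eq_one : ∀ i, 2 ≤ i → Module.finrank R (𝓛 i) = 1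
  span_lie : ∀ i, 1 ≤ i →
    Submodule.span R {z : L | ∃ u ∈ 𝓛 i, ∃ a ∈ 𝓛 1, ⁅u, a⁆ = z} = 𝓛 (i + 1)

/-- The two-step centraliser `C_i = {a ∈ 𝓛 1 | [a, 𝓛 i] = 0}`. -/
def twoStepCentralizer (𝓛 : ℕ → Submodule R L) (i : ℕ) : Submodule R L where
  carrier := {a | a ∈ 𝓛 1 ∧ ∀ u ∈ 𝓛 i, ⁅a, u⁆ = 0}
  add_mem' := by
    rintro a b ⟨ha, ha'⟩ ⟨hb, hb'⟩
    exact ⟨add_mem ha hb, fun u hu => by rw [add_lie, ha' u hu, hb' u hu, add_zero]⟩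
  zero_mem' := ⟨zero_mem _, fun u _ => zero_lie u⟩
  smul_mem' := by
    rintro c a ⟨ha, ha'⟩
    exact ⟨Submodule.smul_mem _ c ha, fun u hu => by rw [smul_lie, ha' u hu, smul_zero]⟩

/-- An ideal is graded if it is the sum of its intersections with the homogeneous components. -/
def IsGradedIdeal (𝓛 : ℕ → Submodule R L) (I : LieIdeal R L) : Prop :=
  (I.toSubmodule : Submodule R L) = ⨆ i, I.toSubmodule ⊓ 𝓛 i

variable (L) in
/-- The `i`-th Lie power `L^i`, for `i ≥ 1`: `L^1 = L` and `L^(i+1) = [L^i, L]`. (Mathlib's lower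
central series starts at index `0`.) -/
def liePower (i : ℕ) : LieIdeal R L :=
  LieModule.lowerCentralSeries R L L (i - 1)

/-- A graded Lie algebra generated by its component of degree `1` is ideally `r`-constrained,
for a positive integer `r`, if every nonzero graded ideal `I` satisfies `L^i ⊇ I ⊇ L^(i+r)` for
some positive integer `i`. -/
structure IsIdeallyConstrained (𝓛 : ℕ → Submodule R L) (r : ℕ) : Prop where
  isLieGrading : IsLieGrading R 𝓛
  generated : LieSubalgebra.lieSpan R L (𝓛 1 : Set L) = ⊤
  pos : 0 < r
  constrained : ∀ I : LieIdeal R L, IsGradedIdeal R 𝓛 I → I ≠ ⊥ →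
    ∃ i, 1 ≤ i ∧ I ≤ liePower R L i ∧ liePower R L (i + r) ≤ I

end Graded

section Subalgebra

variable (F : Type*) {E M : Type*} [Field F] [Field E] [Algebra F E] [LieRing M] [LieAlgebra E M]
  [LieAlgebra F M] [IsScalarTower F E M]

/-- The homogeneous component `L_i = L ∩ M_i` of an `F`-subalgebra `L` of the graded
`E`-algebra `M`, as a family of `F`-subspaces of `L`. -/
def component (𝓜 : ℕ → Submodule E M) (L : LieSubalgebra F M) (i : ℕ) : Submodule F L :=
  Submodule.comap (L.incl : L →ₗ[F] M) ((𝓜 i).restrictScalars F)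

/-- `d_i = dim_F (C_i ∩ L_1)`, where `C_i` is the two-step centraliser in `M`. -/
noncomputable def centralizerDim (𝓜 : ℕ → Submodule E M) (L : LieSubalgebra F M) (i : ℕ) : ℕ :=
  Module.finrank F
    ↥(component F 𝓜 L 1 ⊓
      Submodule.comap (L.incl : L →ₗ[F] M) ((twoStepCentralizer E 𝓜 i).restrictScalars F))

end Subalgebra

end ThinLie

/-! Everything is governed by the zeros of $d$. For $n\ge 2$ a nonzero $u\in L_n$ spans $M_n$ over
$E$, so $\mathrm{ad}\,u$ has kernel $C_n\cap L_1$ on $L_1$, and $[u,L_1]$ has $F$-dimension $2-d_n$.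
The $E$-line $C_n$ cannot contain both $X$ and $Y$, so $d_n\le 1$; also $\dim_F L_n\le |E:F|=2$.
Hence the dimension is 1 from degree 2 up to $t_1$ and 2 afterwards.

If $d_n=0$, any nonzero element of $L_n$ generates all of $L_{n+1}$ (`component_succ_le`); if
$d_n=1$, a line is multiplied to a line. An ideal starting in degree $i>t_1$ therefore contains
$L_{s+1}$, where $s$ is the first zero of $d$ with $s\ge i$, and $s+1\le i+r$. An ideal generated by
one element just after the start of a longest gap is still a line in degree $i+r-1$, so $r-1$ fails.

The gaps are bounded because each centraliser $C_a$ recurs within every $a$ steps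
(`exists_twoStepCentralizer_eq`). Let $C_m=C_a$ and let $x$ lie in it; then $[u,[v,x]]=[[u,v],x]$
for $u\in M_m$ by Jacobi. Either $[M_m,M_s]\ne 0=[M_m,M_{s+1}]$ for some $s<a$, and then
$C_{m+s}=C_a$; or $[M_m,M_a]\ne 0$, and $[M_a,x]=0$ gives $C_{m+a}=C_a$. As $d_i$ depends only on
$C_i$, the case $a=t_1$ bounds the gaps, and an index with $d_i\ne 0$ recurs too, which forces $r\ge
2$. -/

namespace ThinLie

/-! ### Recurrence of two-step centralisers in algebras of maximal class. -/

section MaximalClass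

variable {E M : Type*} [Field E] [LieRing M] [LieAlgebra E M] {𝓜 : ℕ → Submodule E M}

namespace IsMaximalClass

theorem lie_mem (hM : IsMaximalClass E 𝓜) {m n : ℕ} {u v : M} (hu : u ∈ 𝓜 m) (hv : v ∈ 𝓜 n) :
    ⁅u, v⁆ ∈ 𝓜 (m + n) :=
  hM.gradedBracket.bracket_mem hu hv

theorem eq_span_singleton (hM : IsMaximalClass E 𝓜) {n : ℕ} (hn : 2 ≤ n) {u : M} (hu : u ∈ 𝓜 n)
    (hu0 : u ≠ 0) : 𝓜 n = Submodule.span E {u} := by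
  have h1 := hM.finrank_eq_one n hn
  have : FiniteDimensional E (𝓜 n) := FiniteDimensional.of_finrank_eq_succ h1
  refine (Submodule.eq_of_le_of_finrank_eq ?_ ?_).symm
  · simpa using hu
  · rw [h1, finrank_span_singleton hu0]

theorem exists_ne_zero (hM : IsMaximalClass E 𝓜) {n : ℕ} (hn : 2 ≤ n) :
    ∃ u ∈ 𝓜 n, u ≠ 0 := by
  apply Submodule.exists_mem_ne_zero_of_ne_bot
  intro h
  have h1 := hM.finrank_eq_one n hn
  rw [h, finrank_bot] at h1
  exact zero_ne_one h1

theorem mem_twoStepCentralizer_of_lie_eq_zero (hM : IsMaximalClass E 𝓜) {n : ℕ} (hn : 2 ≤ n)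
    {u a : M} (hu : u ∈ 𝓜 n) (hu0 : u ≠ 0) (ha : a ∈ 𝓜 1) (h : ⁅a, u⁆ = 0) :
    a ∈ twoStepCentralizer E 𝓜 n := by
  refine ⟨ha, fun v hv => ?_⟩
  rw [hM.eq_span_singleton hn hu hu0, Submodule.mem_span_singleton] at hv
  obtain ⟨c, rfl⟩ := hv
  rw [lie_smul, h, smul_zero]

theorem exists_lie_ne_zero (hM : IsMaximalClass E 𝓜) {n : ℕ} (hn : 1 ≤ n) :
    ∃ u ∈ 𝓜 n, ∃ a ∈ 𝓜 1, ⁅u, a⁆ ≠ 0 := by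
  by_contra! h
  obtain ⟨v, hv, hv0⟩ := hM.exists_ne_zero (n := n + 1) (by omega)
  rw [← hM.span_lie n hn] at hv
  apply hv0
  rw [← Submodule.mem_bot E]
  refine Submodule.span_le.2 ?_ hv
  rintro _ ⟨u, hu, a, ha, rfl⟩
  exact h u hu a ha

/-- Rank-nullity for $\mathrm{ad}\,u$ on the plane $M_1$: its image is nonzero in the line
$M_{n+1}$. -/
theorem finrank_twoStepCentralizer (hM : IsMaximalClass E 𝓜) {n : ℕ} (hn : 2 ≤ n) :
    Module.finrank E (twoStepCentralizer E 𝓜 n) = 1 := by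
  obtain ⟨u, hu, a, ha, hua⟩ := hM.exists_lie_ne_zero (n := n) (by omega)
  have hu0 : u ≠ 0 := by rintro rfl; simp at hua
  have : FiniteDimensional E (𝓜 1) := FiniteDimensional.of_finrank_eq_succ hM.finrank_one
  have : FiniteDimensional E (𝓜 (n + 1)) :=
    FiniteDimensional.of_finrank_eq_succ (hM.finrank_eq_one (n + 1) (by omega))
  let φ : 𝓜 1 →ₗ[E] M := (LieAlgebra.ad E M u : M →ₗ[E] M) ∘ₗ (𝓜 1).subtype
  have hrange : Module.finrank E (LinearMap.range φ) = 1 := by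
    have hle : LinearMap.range φ ≤ 𝓜 (n + 1) := by
      rintro _ ⟨x, rfl⟩
      exact hM.lie_mem hu x.2
    refine le_antisymm ((Submodule.finrank_mono hle).trans
      (hM.finrank_eq_one _ (by omega)).le) ?_
    rw [Submodule.one_le_finrank_iff]
    intro h
    have : φ ⟨a, ha⟩ ∈ LinearMap.range φ := ⟨_, rfl⟩
    rw [h] at this
    exact hua this
  have hker : (LinearMap.ker φ).map (𝓜 1).subtype = twoStepCentralizer E 𝓜 n := by
    ext x
    constructor
    · rintro ⟨y, hy, rfl⟩
      refine hM.mem_twoStepCentralizer_of_lie_eq_zero hn hu hu0 y.2 ?_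
      have : ⁅u, (y : M)⁆ = 0 := hy
      rw [Submodule.subtype_apply, ← lie_skew, this, neg_zero]
    · rintro ⟨h1, h2⟩
      refine ⟨⟨x, h1⟩, ?_, rfl⟩
      change ⁅u, x⁆ = 0
      rw [← lie_skew, h2 u hu, neg_zero]
  have h := LinearMap.finrank_range_add_finrank_ker φ
  rw [hrange, hM.finrank_one] at h
  rw [← hker, Submodule.finrank_map_subtype_eq]
  omega

theorem twoStepCentralizer_eq_of_le (hM : IsMaximalClass E 𝓜) {m n : ℕ} (hm : 2 ≤ m) (hn : 2 ≤ n)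
    (h : twoStepCentralizer E 𝓜 m ≤ twoStepCentralizer E 𝓜 n) :
    twoStepCentralizer E 𝓜 m = twoStepCentralizer E 𝓜 n := by
  have : FiniteDimensional E (twoStepCentralizer E 𝓜 n) :=
    FiniteDimensional.of_finrank_eq_succ (hM.finrank_twoStepCentralizer hn)
  refine Submodule.eq_of_le_of_finrank_eq h ?_
  rw [hM.finrank_twoStepCentralizer hm, hM.finrank_twoStepCentralizer hn]

/-- If `[u, v] ≠ 0` and `[u, [v, x]] = 0` for all `x` in the centraliser of the component of `u`,
then the components of `u` and of `[u, v]` have the same two-step centraliser. -/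
theorem twoStepCentralizer_add_eq (hM : IsMaximalClass E 𝓜) {m s : ℕ} (hm : 2 ≤ m)
    {u v : M} (hu : u ∈ 𝓜 m) (hv : v ∈ 𝓜 s) (huv : ⁅u, v⁆ ≠ 0)
    (h : ∀ x ∈ twoStepCentralizer E 𝓜 m, ⁅u, ⁅v, x⁆⁆ = 0) :
    twoStepCentralizer E 𝓜 (m + s) = twoStepCentralizer E 𝓜 m := by
  refine (hM.twoStepCentralizer_eq_of_le hm (by omega) fun x hx => ?_).symm
  refine hM.mem_twoStepCentralizer_of_lie_eq_zero (by omega) (hM.lie_mem hu hv) huv hx.1 ?_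
  have h1 := h x hx
  have h2 : ⁅u, x⁆ = 0 := by rw [← lie_skew, hx.2 u hu, neg_zero]
  rw [leibniz_lie, h2, lie_zero, add_zero] at h1
  rw [← lie_skew, h1, neg_zero]

/-- The two-step centraliser `C_a` recurs with gaps at most `a`. -/
theorem exists_twoStepCentralizer_add_eq (hM : IsMaximalClass E 𝓜) {m a : ℕ} (hm : 2 ≤ m)
    (ha : 2 ≤ a) (h : twoStepCentralizer E 𝓜 m = twoStepCentralizer E 𝓜 a) :
    ∃ g, 1 ≤ g ∧ g ≤ a ∧ twoStepCentralizer E 𝓜 (m + g) = twoStepCentralizer E 𝓜 a := by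
  by_contra! hne
  -- If $[M_m,M_{s+1}]$ vanished right after a nonzero $[M_m,M_s]$, the centraliser would already
  -- recur at $m+s$.
  have key : ∀ s, 1 ≤ s → s ≤ a → ∃ u ∈ 𝓜 m, ∃ v ∈ 𝓜 s, ⁅u, v⁆ ≠ 0 := by
    intro s hs
    induction s, hs using Nat.le_induction with
    | base => exact fun _ => hM.exists_lie_ne_zero (by omega)
    | succ s hs ih =>
      intro hsa
      obtain ⟨u, hu, v, hv, huv⟩ := ih (by omega)
      by_contra! h0
      refine hne s hs (by omega) (Eq.trans ?_ h)
      exact hM.twoStepCentralizer_add_eq hm hu hv huv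
        fun x hx => h0 u hu _ (hM.lie_mem hv hx.1)
  obtain ⟨u, hu, v, hv, huv⟩ := key a (by omega) le_rfl
  refine hne a (by omega) le_rfl (Eq.trans ?_ h)
  -- At $s=a$ the inner bracket vanishes by itself, since $x\in C_m=C_a$ and $v\in M_a$.
  refine hM.twoStepCentralizer_add_eq hm hu hv huv fun x hx => ?_
  rw [h] at hx
  rw [← lie_skew v x, hx.2 v hv, neg_zero, lie_zero]

/-- Every interval of length `a` beyond `a` meets the set of indices whose two-step centraliser
is `C_a`. -/
theorem exists_twoStepCentralizer_eq (hM : IsMaximalClass E 𝓜) {a : ℕ} (ha : 2 ≤ a) {m : ℕ}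
    (hm : a ≤ m) :
    ∃ n, m < n ∧ n ≤ m + a ∧ twoStepCentralizer E 𝓜 n = twoStepCentralizer E 𝓜 a := by
  induction m, hm using Nat.le_induction with
  | base =>
    obtain ⟨g, h1, h2, h3⟩ := hM.exists_twoStepCentralizer_add_eq ha ha rfl
    exact ⟨a + g, by omega, by omega, h3⟩
  | succ m hm ih =>
    obtain ⟨n, h1, h2, h3⟩ := ih
    rcases eq_or_ne n (m + 1) with rfl | hn
    · obtain ⟨g, h4, h5, h6⟩ := hM.exists_twoStepCentralizer_add_eq (by omega) ha h3
      exact ⟨_, by omega, by omega, h6⟩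
    · exact ⟨n, by omega, by omega, h3⟩

end IsMaximalClass

end MaximalClass

end ThinLie

namespace ThinLie

/-! ### Multiplying subspaces by two generators. -/

section LieSup

variable {F L : Type*} [Field F] [LieRing L] [LieAlgebra F L]

/-- The subspace `[X, W] + [Y, W]`. -/
def lieSup (X Y : L) (W : Submodule F L) : Submodule F L :=
  W.map (LieAlgebra.ad F L X : L →ₗ[F] L) ⊔ W.map (LieAlgebra.ad F L Y : L →ₗ[F] L)

theorem lieSup_le_iff {X Y : L} {W V : Submodule F L} :
    lieSup X Y W ≤ V ↔ ∀ w ∈ W, ⁅X, w⁆ ∈ V ∧ ⁅Y, w⁆ ∈ V := by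
  simp only [lieSup, sup_le_iff, Submodule.map_le_iff_le_comap]
  exact ⟨fun h w hw => ⟨h.1 hw, h.2 hw⟩, fun h => ⟨fun w hw => (h w hw).1, fun w hw => (h w hw).2⟩⟩

theorem lie_left_mem_lieSup (X Y : L) {W : Submodule F L} {w : L} (hw : w ∈ W) :
    ⁅X, w⁆ ∈ lieSup X Y W := (lieSup_le_iff.1 le_rfl w hw).1

theorem lie_right_mem_lieSup (X Y : L) {W : Submodule F L} {w : L} (hw : w ∈ W) :
    ⁅Y, w⁆ ∈ lieSup X Y W := (lieSup_le_iff.1 le_rfl w hw).2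

theorem lieSup_mono {X Y : L} {W V : Submodule F L} (h : W ≤ V) :
    lieSup X Y W ≤ lieSup X Y V :=
  lieSup_le_iff.2 fun _ hw => ⟨lie_left_mem_lieSup X Y (h hw), lie_right_mem_lieSup X Y (h hw)⟩

@[simp]
theorem lieSup_bot (X Y : L) : lieSup X Y (⊥ : Submodule F L) = ⊥ := by
  rw [lieSup, Submodule.map_bot, Submodule.map_bot, sup_bot_eq]

/-- Turns a product with a line into an image under $\mathrm{ad}\,u$, so that rank-nullity applies.
-/
theorem lieSup_span_singleton (X Y u : L) :
    lieSup X Y (Submodule.span F {u}) =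
      (Submodule.span F {X, Y}).map (LieAlgebra.ad F L u : L →ₗ[F] L) := by
  have h : ∀ x : L, Submodule.span F {⁅x, u⁆} = Submodule.span F {⁅u, x⁆} := fun x => by
    rw [← lie_skew, ← Set.neg_singleton, Submodule.span_neg]
  rw [lieSup, Submodule.map_span, Submodule.map_span, Submodule.map_span, Set.image_pair,
    Set.image_singleton, Set.image_singleton, Submodule.span_insert]
  exact congrArg₂ _ (h X) (h Y)

/-- The Lie subalgebra of the elements whose adjoint action preserves a given subspace. -/
def lieStabilizer (S : Submodule F L) : LieSubalgebra F L where
  carrier := {x | ∀ s ∈ S, ⁅x, s⁆ ∈ S}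
  add_mem' := fun ha hb s hs => by rw [add_lie]; exact add_mem (ha s hs) (hb s hs)
  zero_mem' := fun s _ => by rw [zero_lie]; exact zero_mem S
  smul_mem' := fun c a ha s hs => by rw [smul_lie]; exact S.smul_mem c (ha s hs)
  lie_mem' := fun {a b} ha hb s hs => by
    rw [lie_lie]; exact sub_mem (ha _ (hb s hs)) (hb _ (ha s hs))

/-- Stabilisers are subalgebras, so to obtain an ideal it is enough to test the two generators. -/
theorem mem_lieStabilizer_iSup {X Y : L} {W : ℕ → Submodule F L}
    (h : ∀ n, lieSup X Y (W n) ≤ W (n + 1)) :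
    X ∈ lieStabilizer (⨆ n, W n) ∧ Y ∈ lieStabilizer (⨆ n, W n) := by
  have key : lieSup X Y (⨆ n, W n) ≤ ⨆ n, W n := by
    rw [lieSup, Submodule.map_iSup, Submodule.map_iSup, sup_le_iff, iSup_le_iff, iSup_le_iff]
    exact ⟨fun n => (le_sup_left.trans (h n)).trans (le_iSup W (n + 1)),
      fun n => (le_sup_right.trans (h n)).trans (le_iSup W (n + 1))⟩
  exact ⟨fun s hs => (lieSup_le_iff.1 key s hs).1, fun s hs => (lieSup_le_iff.1 key s hs).2⟩

theorem iSup_inf_eq_of_iSupIndep {V : Type*} [AddCommGroup V] [Module F V]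
    {𝓛 W : ℕ → Submodule F V} (h𝓛 : iSupIndep 𝓛) (hW : ∀ n, W n ≤ 𝓛 n) (n : ℕ) :
    (⨆ k, W k) ⊓ 𝓛 n = W n := by
  have h1 : (⨆ k, W k) ≤ W n ⊔ ⨆ k, ⨆ _ : k ≠ n, 𝓛 k := by
    refine iSup_le fun k => ?_
    rcases eq_or_ne k n with rfl | hk
    · exact le_sup_left
    · exact ((hW k).trans (le_iSup₂_of_le k hk le_rfl)).trans le_sup_right
  refine le_antisymm ?_ (le_inf (le_iSup W n) (hW n))
  calc (⨆ k, W k) ⊓ 𝓛 n ≤ (W n ⊔ ⨆ k, ⨆ _ : k ≠ n, 𝓛 k) ⊓ 𝓛 n := inf_le_inf_right _ h1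
    _ = W n ⊔ (⨆ k, ⨆ _ : k ≠ n, 𝓛 k) ⊓ 𝓛 n := sup_inf_assoc_of_le _ (hW n)
    _ = W n := by rw [(h𝓛 n).symm.eq_bot, sup_bot_eq]

end LieSup

/-- A Lie algebra graded over the positive integers, generated by two elements `X`, `Y` of degree
`1`, with components of dimension at most `2`, in which multiplying a nonzero element of degree
`n ≥ 2` by the elements of degree `1` yields a space of dimension `2 - d n`. -/
structure IsTwoGenerated {F L : Type*} [Field F] [LieRing L] [LieAlgebra F L]
    (𝓛 : ℕ → Submodule F L) (X Y : L) (d : ℕ → ℕ) : Prop extends IsLieGrading F 𝓛 where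
  one_eq : 𝓛 1 = Submodule.span F {X, Y}
  succ_eq : ∀ n, 1 ≤ n → 𝓛 (n + 1) = lieSup X Y (𝓛 n)
  finrank_one : Module.finrank F (𝓛 1) = 2
  finrank_two : Module.finrank F (𝓛 2) = 1
  finrank_le : ∀ n, Module.finrank F (𝓛 n) ≤ 2
  le_one : ∀ n, 2 ≤ n → d n ≤ 1
  finrank_lieSup : ∀ n, 2 ≤ n → ∀ u ∈ 𝓛 n, u ≠ 0 →
    Module.finrank F (lieSup X Y (Submodule.span F {u})) + d n = 2
  exists_injOn : ∀ n, 2 ≤ n → ∃ x, (x = X ∨ x = Y) ∧ ∀ u ∈ 𝓛 n, ⁅x, u⁆ = 0 → u = 0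

/-! ### Dimensions of the homogeneous components. -/

namespace IsTwoGenerated

variable {F L : Type*} [Field F] [LieRing L] [LieAlgebra F L]
  {𝓛 : ℕ → Submodule F L} {X Y : L} {d : ℕ → ℕ}

theorem finite (h : IsTwoGenerated 𝓛 X Y d) (n : ℕ) : FiniteDimensional F (𝓛 n) := by
  induction n with
  | zero => rw [h.zero_eq_bot]; infer_instance
  | succ n ih =>
    rcases Nat.eq_zero_or_pos n with rfl | hn
    · exact FiniteDimensional.of_finrank_eq_succ h.finrank_one
    · rw [h.succ_eq n hn, lieSup]; infer_instance

/-- One of the two generators acts injectively in degree $n$. -/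
theorem finrank_le_finrank_succ (h : IsTwoGenerated 𝓛 X Y d) {n : ℕ} (hn : 2 ≤ n) :
    Module.finrank F (𝓛 n) ≤ Module.finrank F (𝓛 (n + 1)) := by
  obtain ⟨x, hx, hinj⟩ := h.exists_injOn n hn
  have := h.finite (n + 1)
  have hle : (𝓛 n).map (LieAlgebra.ad F L x : L →ₗ[F] L) ≤ 𝓛 (n + 1) := by
    rw [h.succ_eq n (by omega), lieSup]
    rcases hx with rfl | rfl
    · exact le_sup_left
    · exact le_sup_right
  refine le_trans (le_of_eq ?_) (Submodule.finrank_mono hle)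
  rw [← LinearMap.range_domRestrict, LinearMap.finrank_range_of_inj]
  rw [← LinearMap.ker_eq_bot, LinearMap.ker_eq_bot']
  exact fun u hu => Subtype.ext (hinj u u.2 hu)

theorem eq_span_singleton {n : ℕ} (h1 : Module.finrank F (𝓛 n) = 1) {u : L} (hu : u ∈ 𝓛 n)
    (hu0 : u ≠ 0) : 𝓛 n = Submodule.span F {u} := by
  have : FiniteDimensional F (𝓛 n) := FiniteDimensional.of_finrank_eq_succ h1
  refine (Submodule.eq_of_le_of_finrank_eq ?_ ?_).symm
  · simpa using hu
  · rw [h1, finrank_span_singleton hu0]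

theorem finrank_succ_add (h : IsTwoGenerated 𝓛 X Y d) {n : ℕ} (hn : 2 ≤ n)
    (h1 : Module.finrank F (𝓛 n) = 1) : Module.finrank F (𝓛 (n + 1)) + d n = 2 := by
  obtain ⟨u, hu, hu0⟩ : ∃ u ∈ 𝓛 n, u ≠ 0 := by
    apply Submodule.exists_mem_ne_zero_of_ne_bot
    intro h0
    rw [h0, finrank_bot] at h1
    exact zero_ne_one h1
  rw [h.succ_eq n (by omega), eq_span_singleton h1 hu hu0, h.finrank_lieSup n hn u hu hu0]

theorem finrank_eq_one (h : IsTwoGenerated 𝓛 X Y d) {a : ℕ} (hmin : ∀ k, 2 ≤ k → k < a → d k ≠ 0)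
    {n : ℕ} (hn : 2 ≤ n) (hna : n ≤ a) : Module.finrank F (𝓛 n) = 1 := by
  induction n, hn using Nat.le_induction with
  | base => exact h.finrank_two
  | succ n hn ih =>
    have h1 := h.finrank_succ_add hn (ih (by omega))
    have h2 := hmin n hn (by omega)
    have h3 := h.le_one n hn
    omega

theorem finrank_eq_two (h : IsTwoGenerated 𝓛 X Y d) {a : ℕ} (ha : 2 ≤ a) (hda : d a = 0)
    (hmin : ∀ k, 2 ≤ k → k < a → d k ≠ 0) {n : ℕ} (hn : a < n) :
    Module.finrank F (𝓛 n) = 2 := by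
  induction n, (Nat.succ_le_of_lt hn) using Nat.le_induction with
  | base =>
    have h1 := h.finrank_succ_add ha (h.finrank_eq_one hmin ha le_rfl)
    simpa [hda] using h1
  | succ n hn ih =>
    have h1 := h.finrank_le_finrank_succ (n := n) (by omega)
    have h2 := h.finrank_le (n + 1)
    have h3 := ih (by omega)
    omega

/-! ### Graded ideals and Lie powers. -/

theorem lieSpan_eq_top (h : IsTwoGenerated 𝓛 X Y d) :
    LieSubalgebra.lieSpan F L (𝓛 1 : Set L) = ⊤ := by
  set K := LieSubalgebra.lieSpan F L (𝓛 1 : Set L)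
  have hsub : 𝓛 1 ≤ K.toSubmodule := fun x hx => LieSubalgebra.subset_lieSpan hx
  have hX : X ∈ 𝓛 1 := by rw [h.one_eq]; exact Submodule.subset_span (by simp)
  have hY : Y ∈ 𝓛 1 := by rw [h.one_eq]; exact Submodule.subset_span (by simp)
  have hle : ∀ n, 𝓛 n ≤ K.toSubmodule := by
    intro n
    induction n with
    | zero => rw [h.zero_eq_bot]; exact bot_le
    | succ n ih =>
      rcases Nat.eq_zero_or_pos n with rfl | hn
      · exact hsub
      · rw [h.succ_eq n hn, lieSup_le_iff]
        exact fun w hw => ⟨K.lie_mem (hsub hX) (ih hw), K.lie_mem (hsub hY) (ih hw)⟩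
  have htop : (⊤ : Submodule F L) ≤ K.toSubmodule := by
    rw [← h.isInternal.submodule_iSup_eq_top]
    exact iSup_le hle
  exact eq_top_iff.2 fun x _ => htop (Submodule.mem_top (x := x))

theorem iSupIndep (h : IsTwoGenerated 𝓛 X Y d) : iSupIndep 𝓛 :=
  h.isInternal.submodule_iSupIndep

/-- The graded ideal with given homogeneous components. -/
def idealOfComponents (h : IsTwoGenerated 𝓛 X Y d) (W : ℕ → Submodule F L)
    (hW : ∀ n, lieSup X Y (W n) ≤ W (n + 1)) : LieIdeal F L where
  toSubmodule := ⨆ n, W n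
  lie_mem := fun {x m} hm => by
    have h1 : LieSubalgebra.lieSpan F L (𝓛 1 : Set L) ≤ lieStabilizer (⨆ n, W n) := by
      rw [LieSubalgebra.lieSpan_le, h.one_eq]
      have h2 := mem_lieStabilizer_iSup hW
      change Submodule.span F {X, Y} ≤ (lieStabilizer (⨆ n, W n)).toSubmodule
      rw [Submodule.span_le, Set.insert_subset_iff, Set.singleton_subset_iff]
      exact h2
    rw [h.lieSpan_eq_top] at h1
    exact h1 (LieSubalgebra.mem_top x) m hm

theorem isGradedIdeal_idealOfComponents (h : IsTwoGenerated 𝓛 X Y d) (W : ℕ → Submodule F L)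
    (hW : ∀ n, lieSup X Y (W n) ≤ W (n + 1)) (hle : ∀ n, W n ≤ 𝓛 n) :
    IsGradedIdeal F 𝓛 (h.idealOfComponents W hW) :=
  (iSup_congr fun n => iSup_inf_eq_of_iSupIndep h.iSupIndep hle n).symm

theorem lieSup_tail_le (h : IsTwoGenerated 𝓛 X Y d) (m n : ℕ) :
    lieSup X Y (if m ≤ n then 𝓛 n else ⊥) ≤ if m ≤ n + 1 then 𝓛 (n + 1) else ⊥ := by
  rcases Nat.eq_zero_or_pos n with rfl | hn
  · simp [h.zero_eq_bot]
  · split_ifs with h1 h2 h2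
    · exact (h.succ_eq n hn).ge
    · omega
    · simp
    · simp

/-- The ideal consisting of the homogeneous components of degree at least `m`. -/
def tail (h : IsTwoGenerated 𝓛 X Y d) (m : ℕ) : LieIdeal F L :=
  h.idealOfComponents _ (h.lieSup_tail_le m)

theorem component_le_tail (h : IsTwoGenerated 𝓛 X Y d) {m n : ℕ} (hmn : m ≤ n) :
    𝓛 n ≤ (h.tail m).toSubmodule :=
  le_iSup_of_le n (if_pos hmn).ge

theorem tail_le (h : IsTwoGenerated 𝓛 X Y d) {m : ℕ} {V : Submodule F L}
    (hV : ∀ n, m ≤ n → 𝓛 n ≤ V) : (h.tail m).toSubmodule ≤ V := by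
  refine iSup_le fun n => ?_
  rcases le_or_gt m n with hmn | hmn
  · exact (if_pos hmn).le.trans (hV n hmn)
  · exact (if_neg hmn.not_ge).le.trans bot_le

theorem component_le_liePower (h : IsTwoGenerated 𝓛 X Y d) {m n : ℕ} (hmn : m ≤ n) :
    𝓛 n ≤ (liePower F L m).toSubmodule := by
  unfold liePower
  rcases Nat.eq_zero_or_pos n with rfl | hn
  · rw [h.zero_eq_bot]; exact bot_le
  -- Truncated subtraction identifies the powers with $m=0$ and $m=1$; the bound survives because
  -- $n>0$.
  have hmn' : m - 1 + 1 ≤ n := by omega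
  clear hmn
  generalize m - 1 = k at hmn'
  induction k generalizing n with
  | zero => exact fun x _ => by simp
  | succ k ih =>
    obtain ⟨n, rfl⟩ : ∃ j, n = j + 1 := ⟨n - 1, by omega⟩
    rw [h.succ_eq n (by omega), lieSup_le_iff, LieModule.lowerCentralSeries_succ]
    intro w hw
    have hw' := ih (n := n) (by omega) (by omega) hw
    exact ⟨LieSubmodule.lie_mem_lie (LieSubmodule.mem_top X) hw',
      LieSubmodule.lie_mem_lie (LieSubmodule.mem_top Y) hw'⟩

/-- With `component_le_liePower`, this identifies $L^m$ with the sum of the components of degree at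
least $m$. -/
theorem liePower_le_tail (h : IsTwoGenerated 𝓛 X Y d) {m : ℕ} (hm : 1 ≤ m) :
    liePower F L m ≤ h.tail m := by
  have htop : ∀ V : Submodule F L, (∀ n, 1 ≤ n → 𝓛 n ≤ V) → V = ⊤ := by
    intro V hV
    rw [eq_top_iff, ← h.isInternal.submodule_iSup_eq_top]
    refine iSup_le fun n => ?_
    rcases Nat.eq_zero_or_pos n with rfl | hn
    · rw [h.zero_eq_bot]; exact bot_le
    · exact hV n hn
  obtain ⟨k, rfl⟩ : ∃ k, m = k + 1 := ⟨m - 1, by omega⟩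
  clear hm
  simp only [liePower, Nat.add_sub_cancel]
  induction k with
  | zero =>
    rw [← LieSubmodule.toSubmodule_le_toSubmodule,
      htop (h.tail (0 + 1)).toSubmodule fun n hn => h.component_le_tail hn]
    exact le_top
  | succ k ih =>
    rw [LieModule.lowerCentralSeries_succ, LieSubmodule.lie_le_iff]
    intro x _ v hv
    have hv' : v ∈ (h.tail (k + 1)).toSubmodule := ih hv
    have hstep : ∀ n, 1 ≤ n → ∀ y ∈ 𝓛 n, ⁅y, v⁆ ∈ (h.tail (k + 1 + 1)).toSubmodule := by
      intro n hn y hy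
      have := h.tail_le (m := k + 1)
        (V := (h.tail (k + 1 + 1)).toSubmodule.comap (LieAlgebra.ad F L y : L →ₗ[F] L))
        fun j hj z hz => h.component_le_tail (n := n + j) (by omega)
          (h.gradedBracket.bracket_mem hy hz)
      exact this hv'
    -- For fixed `v`, the admissible left factors form a subspace; containing every component, it is
    -- everything.
    have hx := htop ((h.tail (k + 1 + 1)).toSubmodule.comap
      ((LieModule.toEnd F L L : L →ₗ[F] Module.End F L).flip v)) hstep
    have hx' : x ∈ (h.tail (k + 1 + 1)).toSubmodule.comap
      ((LieModule.toEnd F L L : L →ₗ[F] Module.End F L).flip v) := hx ▸ Submodule.mem_top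
    exact hx'

theorem tail_inf_eq_bot (h : IsTwoGenerated 𝓛 X Y d) {m n : ℕ} (hnm : n < m) :
    (h.tail m).toSubmodule ⊓ 𝓛 n = ⊥ := by
  refine (iSup_inf_eq_of_iSupIndep h.iSupIndep (fun k => ?_) n).trans (if_neg (by omega))
  split_ifs
  · exact le_rfl
  · exact bot_le

/-! ### Growth of ideals and the constrainedness index. -/

theorem component_le_of_le (h : IsTwoGenerated 𝓛 X Y d) {I : LieIdeal F L} {m n : ℕ} (hm : 1 ≤ m)
    (hI : 𝓛 m ≤ I.toSubmodule) (hmn : m ≤ n) : 𝓛 n ≤ I.toSubmodule := by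
  induction n, hmn using Nat.le_induction with
  | base => exact hI
  | succ n hn ih =>
    rw [h.succ_eq n (by omega), lieSup_le_iff]
    exact fun w hw => ⟨I.lie_mem (ih hw), I.lie_mem (ih hw)⟩

theorem exists_mem_ideal_of_le (h : IsTwoGenerated 𝓛 X Y d) {I : LieIdeal F L} {m n : ℕ}
    (hm : 2 ≤ m) (hI : ∃ w ∈ 𝓛 m, w ∈ I ∧ w ≠ 0) (hmn : m ≤ n) :
    ∃ w ∈ 𝓛 n, w ∈ I ∧ w ≠ 0 := by
  induction n, hmn using Nat.le_induction with
  | base => exact hI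
  | succ n hn ih =>
    obtain ⟨w, hw, hwI, hw0⟩ := ih
    obtain ⟨x, hx, hinj⟩ := h.exists_injOn n (by omega)
    refine ⟨⁅x, w⁆, ?_, I.lie_mem hwI, fun h0 => hw0 (hinj w hw h0)⟩
    rw [h.succ_eq n (by omega)]
    rcases hx with rfl | rfl
    · exact lie_left_mem_lieSup _ _ hw
    · exact lie_right_mem_lieSup _ _ hw

/-- When $d_n=0$, the product of a single nonzero $w$ with $L_1$ has dimension 2, the most $L_{n+1}$
can have. -/
theorem component_succ_le (h : IsTwoGenerated 𝓛 X Y d) {I : LieIdeal F L} {n : ℕ} (hn : 2 ≤ n)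
    (hd : d n = 0) (hI : ∃ w ∈ 𝓛 n, w ∈ I ∧ w ≠ 0) : 𝓛 (n + 1) ≤ I.toSubmodule := by
  obtain ⟨w, hw, hwI, hw0⟩ := hI
  have hspan : Submodule.span F {w} ≤ 𝓛 n := by simpa using hw
  have hle : lieSup X Y (Submodule.span F {w}) ≤ 𝓛 (n + 1) := by
    rw [h.succ_eq n (by omega)]
    exact lieSup_mono hspan
  have := h.finite (n + 1)
  have heq := Submodule.eq_of_le_of_finrank_le hle (by
    have h1 := h.finrank_lieSup n hn w hw hw0
    have h2 := h.finrank_le (n + 1)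
    omega)
  rw [← heq, lieSup_le_iff]
  have hspanI : Submodule.span F {w} ≤ I.toSubmodule := by simpa using hwI
  exact fun z hz => ⟨I.lie_mem (hspanI hz), I.lie_mem (hspanI hz)⟩

theorem component_le_of_finrank_eq_one {I : LieIdeal F L} {n : ℕ}
    (h1 : Module.finrank F (𝓛 n) = 1) (hI : ∃ w ∈ 𝓛 n, w ∈ I ∧ w ≠ 0) :
    𝓛 n ≤ I.toSubmodule := by
  obtain ⟨w, hw, hwI, hw0⟩ := hI
  rw [eq_span_singleton h1 hw hw0]
  simpa using hwI

/-- Bracketing $\alpha X+\beta Y$ with $X$ and $Y$ gives $\beta[X,Y]$ and $-\alpha[X,Y]$, which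
cannot both vanish. -/
theorem component_two_le (h : IsTwoGenerated 𝓛 X Y d) {I : LieIdeal F L}
    (hI : ∃ w ∈ 𝓛 1, w ∈ I ∧ w ≠ 0) : 𝓛 2 ≤ I.toSubmodule := by
  obtain ⟨w, hw, hwI, hw0⟩ := hI
  refine component_le_of_finrank_eq_one h.finrank_two ?_
  by_contra! hne
  have hXw : ⁅X, w⁆ = 0 := by
    refine hne _ ?_ (I.lie_mem hwI)
    rw [h.succ_eq 1 le_rfl]
    exact lie_left_mem_lieSup X Y hw
  have hYw : ⁅Y, w⁆ = 0 := by
    refine hne _ ?_ (I.lie_mem hwI)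
    rw [h.succ_eq 1 le_rfl]
    exact lie_right_mem_lieSup X Y hw
  rw [h.one_eq, Submodule.mem_span_pair] at hw
  obtain ⟨α, β, rfl⟩ := hw
  simp only [lie_add, lie_smul, lie_self, smul_zero, zero_add, add_zero] at hXw hYw
  have hXY : ⁅X, Y⁆ = 0 := by
    by_contra hXY
    rw [← lie_skew, smul_neg, neg_eq_zero] at hYw
    have hβ := (smul_eq_zero.1 hXw).resolve_right hXY
    have hα := (smul_eq_zero.1 hYw).resolve_right hXY
    simp [hα, hβ] at hw0
  have hbot : 𝓛 2 ≤ ⊥ := by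
    rw [h.succ_eq 1 le_rfl, lieSup_le_iff]
    intro z hz
    rw [h.one_eq, Submodule.mem_span_pair] at hz
    obtain ⟨γ, δ, rfl⟩ := hz
    have hYX : ⁅Y, X⁆ = 0 := by rw [← lie_skew, hXY, neg_zero]
    simp [hXY, hYX]
  have h2 := h.finrank_two
  rw [le_bot_iff.1 hbot, finrank_bot] at h2
  exact zero_ne_one h2

theorem isIdeallyConstrained (h : IsTwoGenerated 𝓛 X Y d) {a r : ℕ}
    (hmin : ∀ k, 2 ≤ k → k < a → d k ≠ 0) (ha : 2 ≤ a) (hr : 0 < r)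
    (hgap : ∀ i, a < i → ∃ s, d s = 0 ∧ i ≤ s ∧ s + 1 ≤ i + r) :
    IsIdeallyConstrained F 𝓛 r := by
  refine ⟨h.toIsLieGrading, h.lieSpan_eq_top, hr, fun I hI hI0 => ?_⟩
  have hex : ∃ i, I.toSubmodule ⊓ 𝓛 i ≠ ⊥ := by
    by_contra! hbot
    apply hI0
    rw [← LieSubmodule.toSubmodule_eq_bot, hI]
    simp [hbot]
  classical
  -- The lowest degree in which `I` is nonzero determines the Lie power containing it.
  obtain ⟨i, hi, hlt⟩ : ∃ i, I.toSubmodule ⊓ 𝓛 i ≠ ⊥ ∧ ∀ k < i, I.toSubmodule ⊓ 𝓛 k = ⊥ :=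
    ⟨Nat.find hex, Nat.find_spec hex, fun k hk => not_not.1 (Nat.find_min hex hk)⟩
  have hi1 : 1 ≤ i := by
    rw [Nat.one_le_iff_ne_zero]
    rintro rfl
    rw [h.zero_eq_bot, inf_bot_eq] at hi
    exact hi rfl
  have hw : ∃ w ∈ 𝓛 i, w ∈ I ∧ w ≠ 0 := by
    obtain ⟨w, hw, hw0⟩ := Submodule.exists_mem_ne_zero_of_ne_bot hi
    exact ⟨w, hw.2, hw.1, hw0⟩
  -- A degree where `I` contains the full component: 2 when $i=1$, $i$ itself while components are
  -- lines, and otherwise one past the next zero of $d$.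
  obtain ⟨s, hs1, hs, hsI⟩ : ∃ s, 1 ≤ s ∧ s ≤ i + r ∧ 𝓛 s ≤ I.toSubmodule := by
    rcases eq_or_ne i 1 with rfl | hi2
    · exact ⟨2, by omega, by omega, h.component_two_le hw⟩
    rcases le_or_gt i a with hia | hia
    · exact ⟨i, hi1, by omega,
        component_le_of_finrank_eq_one (h.finrank_eq_one hmin (by omega) hia) hw⟩
    · obtain ⟨s, hds, his, hsr⟩ := hgap i hia
      exact ⟨s + 1, by omega, hsr, h.component_succ_le (by omega) hds
        (h.exists_mem_ideal_of_le (by omega) hw his)⟩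
  refine ⟨i, hi1, ?_, ?_⟩
  · rw [← LieSubmodule.toSubmodule_le_toSubmodule, hI]
    refine iSup_le fun k => ?_
    rcases lt_or_ge k i with hk | hk
    · rw [hlt k hk]; exact bot_le
    · exact inf_le_right.trans (h.component_le_liePower hk)
  · refine (h.liePower_le_tail (by omega)).trans ?_
    rw [← LieSubmodule.toSubmodule_le_toSubmodule]
    exact h.tail_le fun n hn => h.component_le_of_le hs1 hsI (by omega)

/-- The ideal generated by one element of degree $i$ remains at most a line up to degree $i+r$, so
it misses part of that component. -/
theorem not_isIdeallyConstrained (h : IsTwoGenerated 𝓛 X Y d) {i r : ℕ} (hi : 2 ≤ i)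
    (hd : ∀ k, i ≤ k → k < i + r → d k ≠ 0) (hfin : 2 ≤ Module.finrank F (𝓛 i))
    (hfin' : 2 ≤ Module.finrank F (𝓛 (i + r))) :
    ¬ IsIdeallyConstrained F 𝓛 r := by
  rintro ⟨-, -, -, hcon⟩
  obtain ⟨w, hw, hw0⟩ : ∃ u ∈ 𝓛 i, u ≠ 0 := by
    apply Submodule.exists_mem_ne_zero_of_ne_bot
    intro h0
    rw [h0, finrank_bot] at hfin
    omega
  let V : ℕ → Submodule F L := fun n => (lieSup X Y)^[n] (Submodule.span F {w})
  have hV : ∀ n, V (n + 1) = lieSup X Y (V n) := fun n => Function.iterate_succ_apply' _ _ _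
  have hVle : ∀ n, V n ≤ 𝓛 (i + n) := by
    intro n
    induction n with
    | zero => simpa [V] using hw
    | succ n ih => rw [hV, ← add_assoc, h.succ_eq (i + n) (by omega)]; exact lieSup_mono ih
  -- Here $d\ne 0$ in degrees $i$ to $i+r-1$, so each multiplication leaves dimension at most 1.
  have hVfin : ∀ n, n ≤ r → Module.finrank F (V n) ≤ 1 := by
    intro n
    induction n with
    | zero => exact fun _ => (finrank_span_singleton hw0).le
    | succ n ih =>
      intro hn
      have := h.finite (i + n)
      have : FiniteDimensional F (V n) := Submodule.finiteDimensional_of_le (hVle n)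
      obtain ⟨v, hv⟩ := finrank_le_one_iff.1 (ih (by omega))
      have hspan : V n = Submodule.span F {(v : L)} := by
        refine le_antisymm (fun x hx => ?_) (by simp)
        obtain ⟨c, hc⟩ := hv ⟨x, hx⟩
        exact Submodule.mem_span_singleton.2 ⟨c, congrArg Subtype.val hc⟩
      rw [hV, hspan]
      rcases eq_or_ne (v : L) 0 with hv0 | hv0
      · rw [hv0, Submodule.span_zero_singleton, lieSup_bot, finrank_bot]
        exact zero_le_one
      · have h1 := h.finrank_lieSup (i + n) (by omega) v (hVle n v.2) hv0
        have h2 := hd (i + n) (by omega) (by omega)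
        omega
  let W : ℕ → Submodule F L := fun n => if i ≤ n then V (n - i) else ⊥
  have hWi : ∀ n, W (i + n) = V n := fun n => by simp [W]
  have hWbot : ∀ n, n < i → W n = ⊥ := fun n hn => if_neg (by omega)
  have hWsucc : ∀ n, lieSup X Y (W n) ≤ W (n + 1) := by
    intro n
    rcases lt_or_ge n i with hn | hn
    · simp [hWbot n hn]
    · obtain ⟨j, rfl⟩ := Nat.exists_eq_add_of_le hn
      rw [add_assoc, hWi, hWi, hV]
  have hWle : ∀ n, W n ≤ 𝓛 n := by
    intro n
    rcases lt_or_ge n i with hn | hn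
    · simp [hWbot n hn]
    · obtain ⟨j, rfl⟩ := Nat.exists_eq_add_of_le hn
      rw [hWi]; exact hVle j
  have hwI : w ∈ h.idealOfComponents W hWsucc := by
    have : W i ≤ ⨆ n, W n := le_iSup W i
    refine this ?_
    rw [← add_zero i, hWi]
    exact Submodule.mem_span_singleton_self w
  obtain ⟨j, hj, hle, hge⟩ := hcon (h.idealOfComponents W hWsucc)
    (h.isGradedIdeal_idealOfComponents W hWsucc hWle) (by
      intro h0
      rw [h0] at hwI
      exact hw0 hwI)
  -- The degree of `w` forces $j\le i$, so $L^{j+r}$ reaches down to degree $i+r$.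
  have hji : j ≤ i := by
    by_contra! hlt
    have h1 : w ∈ (h.tail j).toSubmodule ⊓ 𝓛 i := ⟨h.liePower_le_tail hj (hle hwI), hw⟩
    rw [h.tail_inf_eq_bot hlt] at h1
    exact hw0 h1
  have hsub : 𝓛 (i + r) ≤ V r := by
    rw [← hWi, ← iSup_inf_eq_of_iSupIndep h.iSupIndep hWle (i + r)]
    exact le_inf ((h.component_le_liePower (m := j + r) (by omega)).trans hge) le_rfl
  have := h.finite (i + r)
  have : FiniteDimensional F (V r) := Submodule.finiteDimensional_of_le (hVle r)
  have h1 := Submodule.finrank_mono hsub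
  have h2 := hVfin r le_rfl
  omega

end IsTwoGenerated

end ThinLie

namespace ThinLie

/-! ### Left-normed products span the subalgebra generated by two elements. -/

section Generated

variable {F M : Type*} [Field F] [LieRing M] [LieAlgebra F M]

/-- The span of the left-normed products of `n` factors equal to `X` or `Y`. -/
def lieProducts (F : Type*) {M : Type*} [Field F] [LieRing M] [LieAlgebra F M] (X Y : M) :
    ℕ → Submodule F M
  | 0 => ⊥
  | 1 => Submodule.span F {X, Y}
  | n + 2 => lieSup X Y (lieProducts F X Y (n + 1))

theorem lieProducts_one (X Y : M) : lieProducts F X Y 1 = Submodule.span F {X, Y} := rfl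

theorem lieProducts_succ (X Y : M) {n : ℕ} (hn : 1 ≤ n) :
    lieProducts F X Y (n + 1) = lieSup X Y (lieProducts F X Y n) := by
  obtain ⟨n, rfl⟩ : ∃ k, n = k + 1 := ⟨n - 1, by omega⟩
  rfl

theorem lieSup_lieProducts_le (X Y : M) (n : ℕ) :
    lieSup X Y (lieProducts F X Y n) ≤ lieProducts F X Y (n + 1) := by
  rcases Nat.eq_zero_or_pos n with rfl | hn
  · rw [lieProducts, lieSup_bot]
    exact bot_le
  · exact (lieProducts_succ X Y hn).ge

theorem toSubmodule_lieSpan_pair (X Y : M) :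
    (LieSubalgebra.lieSpan F M {X, Y}).toSubmodule = ⨆ n, lieProducts F X Y n := by
  have hst := mem_lieStabilizer_iSup (lieSup_lieProducts_le (F := F) X Y)
  have h1 : Submodule.span F {X, Y} ≤ ⨆ n, lieProducts F X Y n := le_iSup (lieProducts F X Y) 1
  have hX : X ∈ LieSubalgebra.lieSpan F M {X, Y} := LieSubalgebra.subset_lieSpan (by simp)
  have hY : Y ∈ LieSubalgebra.lieSpan F M {X, Y} := LieSubalgebra.subset_lieSpan (by simp)
  apply le_antisymm
  · let K : LieSubalgebra F M :=
      { (⨆ n, lieProducts F X Y n) ⊓ (lieStabilizer (⨆ n, lieProducts F X Y n)).toSubmodule with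
        lie_mem' := fun ha hb => ⟨ha.2 _ hb.1, LieSubalgebra.lie_mem _ ha.2 hb.2⟩ }
    have hK : LieSubalgebra.lieSpan F M {X, Y} ≤ K := by
      rw [LieSubalgebra.lieSpan_le, Set.insert_subset_iff, Set.singleton_subset_iff]
      exact ⟨⟨h1 (Submodule.subset_span (by simp)), hst.1⟩,
        ⟨h1 (Submodule.subset_span (by simp)), hst.2⟩⟩
    exact fun x hx => (hK hx).1
  · refine iSup_le fun n => ?_
    induction n with
    | zero => exact bot_le
    | succ n ih =>
      rcases Nat.eq_zero_or_pos n with rfl | hn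
      · exact LieSubalgebra.submodule_span_le_lieSpan
      · rw [lieProducts_succ X Y hn, lieSup_le_iff]
        exact fun w hw => ⟨LieSubalgebra.lie_mem _ hX (ih hw), LieSubalgebra.lie_mem _ hY (ih hw)⟩

theorem map_incl_lieSup {L : LieSubalgebra F M} (x y : L) (W : Submodule F L) :
    (lieSup x y W).map (L.incl : L →ₗ[F] M) =
      lieSup (x : M) (y : M) (W.map (L.incl : L →ₗ[F] M)) := by
  rw [lieSup, lieSup, Submodule.map_sup, ← Submodule.map_comp, ← Submodule.map_comp,
    ← Submodule.map_comp, ← Submodule.map_comp]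
  rfl

theorem incl_injective (L : LieSubalgebra F M) :
    Function.Injective (L.incl : L →ₗ[F] M) := Subtype.val_injective

theorem finrank_map_incl {L : LieSubalgebra F M} (W : Submodule F L) :
    Module.finrank F (W.map (L.incl : L →ₗ[F] M)) = Module.finrank F W :=
  (LinearEquiv.finrank_eq (Submodule.equivMapOfInjective _ (incl_injective L) W)).symm

theorem finrank_map_add_finrank_inf_ker {V V' : Type*} [AddCommGroup V] [Module F V]
    [AddCommGroup V'] [Module F V'] (f : V →ₗ[F] V') (S : Submodule F V) [FiniteDimensional F S] :
    Module.finrank F (S.map f) + Module.finrank F ↥(S ⊓ LinearMap.ker f) =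
      Module.finrank F S := by
  have h := LinearMap.finrank_range_add_finrank_ker (f.domRestrict S)
  rw [LinearMap.range_domRestrict] at h
  rw [← h, LinearMap.ker_domRestrict, ← Submodule.finrank_map_subtype_eq,
    Submodule.map_comap_subtype]

end Generated

/-! ### The $F$-subalgebra $L$ inside $M$. -/

section Subalgebra

variable {F E M : Type*} [Field F] [Field E] [Algebra F E] [LieRing M] [LieAlgebra E M]
  [LieAlgebra F M] [IsScalarTower F E M] {𝓜 : ℕ → Submodule E M} {X Y : M}

theorem iSupIndep_restrictScalars (h : iSupIndep 𝓜) :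
    iSupIndep fun n => (𝓜 n).restrictScalars F := by
  intro n
  have h1 := h n
  rw [disjoint_iff] at h1 ⊢
  have h2 := congrArg (Submodule.restrictScalars F) h1
  simpa [Submodule.restrictScalars_inf, Submodule.restrictScalars_iSup] using h2

theorem IsMaximalClass.span_pair_eq (hM : IsMaximalClass E 𝓜) (hX : X ∈ 𝓜 1) (hY : Y ∈ 𝓜 1)
    (hXY : LinearIndependent E ![X, Y]) : 𝓜 1 = Submodule.span E {X, Y} := by
  have : FiniteDimensional E (𝓜 1) := FiniteDimensional.of_finrank_eq_succ hM.finrank_one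
  refine (Submodule.eq_of_le_of_finrank_eq ?_ ?_).symm
  · rw [Submodule.span_le, Set.insert_subset_iff, Set.singleton_subset_iff]
    exact ⟨hX, hY⟩
  · have h := finrank_span_eq_card hXY
    rw [Matrix.range_cons_cons_empty] at h
    rw [hM.finrank_one, h, Fintype.card_fin]

theorem IsMaximalClass.not_mem_twoStepCentralizer (hM : IsMaximalClass E 𝓜) (hX : X ∈ 𝓜 1)
    (hY : Y ∈ 𝓜 1) (hXY : LinearIndependent E ![X, Y]) {n : ℕ} (hn : 2 ≤ n) :
    X ∉ twoStepCentralizer E 𝓜 n ∨ Y ∉ twoStepCentralizer E 𝓜 n := by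
  by_contra! h
  have hle : 𝓜 1 ≤ twoStepCentralizer E 𝓜 n := by
    rw [hM.span_pair_eq hX hY hXY, Submodule.span_le, Set.insert_subset_iff,
      Set.singleton_subset_iff]
    exact h
  have : FiniteDimensional E (twoStepCentralizer E 𝓜 n) :=
    FiniteDimensional.of_finrank_eq_succ (hM.finrank_twoStepCentralizer hn)
  have h1 := Submodule.finrank_mono hle
  rw [hM.finrank_one, hM.finrank_twoStepCentralizer hn] at h1
  omega

theorem IsMaximalClass.lie_ne_zero (hM : IsMaximalClass E 𝓜) (hX : X ∈ 𝓜 1) (hY : Y ∈ 𝓜 1)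
    (hXY : LinearIndependent E ![X, Y]) : ⁅X, Y⁆ ≠ 0 := by
  intro h0
  have h0' : ⁅Y, X⁆ = 0 := by rw [← lie_skew, h0, neg_zero]
  obtain ⟨u, hu, v, hv, huv⟩ := hM.exists_lie_ne_zero le_rfl
  rw [hM.span_pair_eq hX hY hXY, Submodule.mem_span_pair] at hu hv
  obtain ⟨a, b, rfl⟩ := hu
  obtain ⟨c, e, rfl⟩ := hv
  exact huv (by simp [h0, h0'])

theorem lieProducts_le (hM : IsMaximalClass E 𝓜) (hX : X ∈ 𝓜 1) (hY : Y ∈ 𝓜 1) (n : ℕ) :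
    lieProducts F X Y n ≤ (𝓜 n).restrictScalars F := by
  induction n with
  | zero => exact bot_le
  | succ n ih =>
    rcases Nat.eq_zero_or_pos n with rfl | hn
    · rw [zero_add, lieProducts_one, Submodule.span_le, Set.insert_subset_iff,
        Set.singleton_subset_iff]
      exact ⟨hX, hY⟩
    · rw [lieProducts_succ X Y hn, lieSup_le_iff, add_comm]
      exact fun w hw => ⟨hM.lie_mem hX (ih hw), hM.lie_mem hY (ih hw)⟩

/-- The product spaces sum to $L$ and each lies in its own $M_n$, so independence of the $M_n$
isolates them. -/
theorem map_incl_component (hM : IsMaximalClass E 𝓜) (hX : X ∈ 𝓜 1) (hY : Y ∈ 𝓜 1)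
    {L : LieSubalgebra F M} (hL : L = LieSubalgebra.lieSpan F M {X, Y}) (n : ℕ) :
    (component F 𝓜 L n).map (L.incl : L →ₗ[F] M) = lieProducts F X Y n := by
  rw [component, Submodule.map_comap_eq]
  have h1 : LinearMap.range (L.incl : L →ₗ[F] M) = ⨆ n, lieProducts F X Y n := by
    rw [← toSubmodule_lieSpan_pair, ← hL]
    exact Submodule.range_subtype L.toSubmodule
  rw [h1]
  exact iSup_inf_eq_of_iSupIndep
    (iSupIndep_restrictScalars hM.isInternal.submodule_iSupIndep) (lieProducts_le hM hX hY) n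

theorem isLieGrading_component (hM : IsMaximalClass E 𝓜) (hX : X ∈ 𝓜 1) (hY : Y ∈ 𝓜 1)
    {L : LieSubalgebra F M} (hL : L = LieSubalgebra.lieSpan F M {X, Y}) :
    IsLieGrading F (component F 𝓜 L) := by
  have hmap := Submodule.map_injective_of_injective (incl_injective L)
  refine ⟨?_, ?_, ⟨fun i j u v hu hv => hM.lie_mem (u := (u : M)) (v := (v : M)) hu hv⟩⟩
  · apply DirectSum.isInternal_submodule_of_iSupIndep_of_iSup_eq_top
    · intro n
      rw [Submodule.disjoint_def]
      intro x hx hx'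
      have h1 := iSupIndep_restrictScalars (F := F) hM.isInternal.submodule_iSupIndep n
      rw [Submodule.disjoint_def] at h1
      refine Subtype.ext (h1 (x : M) hx ?_)
      have h2 := Submodule.mem_map_of_mem (f := (L.incl : L →ₗ[F] M)) hx'
      simp only [Submodule.map_iSup] at h2
      have h3 : (⨆ k, ⨆ _ : k ≠ n, (component F 𝓜 L k).map (L.incl : L →ₗ[F] M)) ≤
          ⨆ k, ⨆ _ : k ≠ n, (𝓜 k).restrictScalars F :=
        iSup₂_mono fun k _ => Submodule.map_comap_le _ _
      exact h3 h2
    · apply hmap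
      rw [Submodule.map_iSup, iSup_congr (map_incl_component hM hX hY hL),
        ← toSubmodule_lieSpan_pair, ← hL, Submodule.map_top]
      exact (Submodule.range_subtype L.toSubmodule).symm
  · apply hmap
    rw [map_incl_component hM hX hY hL, Submodule.map_bot]
    rfl

/-- A nonzero `u` spans $M_n$ over $E$, so commuting with `u` alone means centralising $M_n$. -/
theorem component_inf_ker_ad (hM : IsMaximalClass E 𝓜) {L : LieSubalgebra F M} {n : ℕ}
    (hn : 2 ≤ n) {u : L} (hu : u ∈ component F 𝓜 L n) (hu0 : u ≠ 0) :
    component F 𝓜 L 1 ⊓ LinearMap.ker (LieAlgebra.ad F L u : L →ₗ[F] L) =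
      component F 𝓜 L 1 ⊓
        Submodule.comap (L.incl : L →ₗ[F] M) ((twoStepCentralizer E 𝓜 n).restrictScalars F) := by
  ext x
  refine and_congr_right fun hx => ⟨fun h => ?_, fun h => ?_⟩
  · have h1 : ⁅u, x⁆ = 0 := h
    have h2 : ⁅x, u⁆ = 0 := by rw [← lie_skew, h1, neg_zero]
    exact hM.mem_twoStepCentralizer_of_lie_eq_zero (u := (u : M)) hn hu
      (fun h0 => hu0 (Subtype.ext h0)) hx (congrArg Subtype.val h2)
  · have h1 : ⁅x, u⁆ = 0 := Subtype.ext (h.2 u hu)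
    have h2 : ⁅u, x⁆ = 0 := by rw [← lie_skew, h1, neg_zero]
    exact h2

theorem isTwoGenerated_component (hFE : Module.finrank F E = 2) (hM : IsMaximalClass E 𝓜)
    (hX : X ∈ 𝓜 1) (hY : Y ∈ 𝓜 1) (hXY : LinearIndependent E ![X, Y])
    {L : LieSubalgebra F M} (hL : L = LieSubalgebra.lieSpan F M {X, Y})
    (hXL : X ∈ L) (hYL : Y ∈ L) :
    IsTwoGenerated (component F 𝓜 L) ⟨X, hXL⟩ ⟨Y, hYL⟩ (centralizerDim F 𝓜 L) := by
  have hmap := Submodule.map_injective_of_injective (incl_injective L)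
  have hcomp := map_incl_component hM hX hY hL
  have hfr : ∀ n, Module.finrank F (component F 𝓜 L n) =
      Module.finrank F (lieProducts F X Y n) := fun n => by rw [← hcomp, finrank_map_incl]
  have hone : component F 𝓜 L 1 = Submodule.span F {⟨X, hXL⟩, ⟨Y, hYL⟩} := by
    apply hmap
    rw [hcomp, lieProducts_one, Submodule.map_span, Set.image_pair]
    rfl
  have hfr1 : Module.finrank F (component F 𝓜 L 1) = 2 := by
    have hXYF : LinearIndependent F ![X, Y] := hXY.restrict_scalars' F
    have h := finrank_span_eq_card hXYF
    rw [Matrix.range_cons_cons_empty] at h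
    rw [hfr, lieProducts_one, h, Fintype.card_fin]
  have hfin1 : FiniteDimensional F (component F 𝓜 L 1) :=
    FiniteDimensional.of_finrank_eq_succ hfr1
  have hfinE : FiniteDimensional F E := FiniteDimensional.of_finrank_eq_succ hFE
  refine ⟨isLieGrading_component hM hX hY hL, hone, fun n hn => ?_, hfr1, ?_, fun n => ?_,
    fun n hn => ?_, fun n hn u hu hu0 => ?_, fun n hn => ?_⟩
  · apply hmap
    rw [map_incl_lieSup, hcomp, hcomp, lieProducts_succ X Y hn]
  · have h2 : lieProducts F X Y 2 = Submodule.span F {⁅X, Y⁆} := by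
      rw [lieProducts_succ X Y le_rfl, lieProducts_one]
      apply le_antisymm
      · rw [lieSup_le_iff]
        intro w hw
        obtain ⟨a, b, rfl⟩ := Submodule.mem_span_pair.1 hw
        refine ⟨Submodule.mem_span_singleton.2 ⟨b, by simp⟩,
          Submodule.mem_span_singleton.2 ⟨-a, ?_⟩⟩
        rw [lie_add, lie_smul, lie_smul, lie_self, smul_zero, add_zero, ← lie_skew Y X, smul_neg,
          neg_smul]
      · rw [Submodule.span_singleton_le_iff_mem]
        exact lie_left_mem_lieSup X Y (Submodule.subset_span (by simp))
    rw [hfr, h2, finrank_span_singleton (hM.lie_ne_zero hX hY hXY)]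
  · rcases lt_or_ge n 2 with hn | hn
    · interval_cases n
      · rw [hfr, lieProducts, finrank_bot]; omega
      · exact hfr1.le
    · have h1 := hM.finrank_eq_one n hn
      have : FiniteDimensional E (𝓜 n) := FiniteDimensional.of_finrank_eq_succ h1
      have hfinF : FiniteDimensional F (𝓜 n) := Module.Finite.trans E _
      have hfinF' : FiniteDimensional F ((𝓜 n).restrictScalars F) := hfinF
      have h2 : Module.finrank F ((𝓜 n).restrictScalars F) = 2 := by
        have h3 := Module.finrank_mul_finrank F E (𝓜 n)
        rw [hFE, h1] at h3
        exact h3.symm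
      rw [hfr, ← h2]
      exact Submodule.finrank_mono (lieProducts_le hM hX hY n)
  -- Dimension 2 would put $L_1$, hence both $X$ and $Y$, inside $C_n$.
  · by_contra! hlt
    have heq := Submodule.eq_of_le_of_finrank_le (inf_le_left : component F 𝓜 L 1 ⊓
      Submodule.comap (L.incl : L →ₗ[F] M) ((twoStepCentralizer E 𝓜 n).restrictScalars F) ≤ _)
      (hfr1.le.trans hlt)
    have hle := inf_eq_left.1 heq
    rcases hM.not_mem_twoStepCentralizer hX hY hXY hn with h | h
    · exact h (hle (show (⟨X, hXL⟩ : L) ∈ component F 𝓜 L 1 from hX))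
    · exact h (hle (show (⟨Y, hYL⟩ : L) ∈ component F 𝓜 L 1 from hY))
  · rw [lieSup_span_singleton, ← hone, centralizerDim, ← component_inf_ker_ad hM hn hu hu0,
      finrank_map_add_finrank_inf_ker, hfr1]
  · have key : ∀ Z : M, (hZ : Z ∈ 𝓜 1) → (hZL : Z ∈ L) → Z ∉ twoStepCentralizer E 𝓜 n →
        ∀ u ∈ component F 𝓜 L n, ⁅(⟨Z, hZL⟩ : L), u⁆ = 0 → u = 0 := by
      intro Z hZ hZL hZC u hu h0
      by_contra hu0
      exact hZC (hM.mem_twoStepCentralizer_of_lie_eq_zero (u := (u : M)) hn hu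
        (fun h1 => hu0 (Subtype.ext h1)) hZ (congrArg Subtype.val h0))
    rcases hM.not_mem_twoStepCentralizer hX hY hXY hn with h | h
    · exact ⟨_, Or.inl rfl, key X hX hXL h⟩
    · exact ⟨_, Or.inr rfl, key Y hY hYL h⟩

end Subalgebra

/-- Enumeration of a set of natural numbers whose gaps are bounded by its least element. -/
theorem exists_strictMono_enumeration {P : ℕ → Prop} {a : ℕ} (hPa : P a) (hmin : ∀ k < a, ¬ P k)
    (hgap : ∀ m, a ≤ m → ∃ n, m < n ∧ n ≤ m + a ∧ P n) (hnot : ∃ i, a < i ∧ ¬ P i) :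
    ∃ t : ℕ → ℕ, StrictMono t ∧ Set.range t = {i | P i} ∧ t 0 = a ∧
      (∀ j, t (j + 1) - t j ≤ a) ∧
      ∃ r, IsGreatest {s : ℕ | ∃ j, s = t (j + 1) - t j} r ∧ 2 ≤ r ∧
        (∀ i, a < i → ∃ s, P s ∧ i ≤ s ∧ s + 1 ≤ i + r) ∧
        ∃ i, a < i ∧ ∀ k, i ≤ k → k < i + (r - 1) → ¬ P k := by
  have hinf : {i | P i}.Infinite := by
    rw [Set.infinite_iff_exists_gt]
    intro m
    obtain ⟨n, h1, -, h2⟩ := hgap (m + a) (by omega)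
    exact ⟨n, h2, by omega⟩
  let t := Nat.nth P
  have hmono : StrictMono t := Nat.nth_strictMono hinf
  have hrange : Set.range t = {i | P i} := Nat.range_nth_of_infinite hinf
  have hPt : ∀ j, P (t j) := Nat.nth_mem_of_infinite hinf
  have hex : ∀ i, P i → ∃ j, t j = i := fun i hi => by
    have : i ∈ Set.range t := hrange ▸ hi
    exact this
  have ht0 : t 0 = a := by
    obtain ⟨j, hj⟩ := hex a hPa
    refine le_antisymm (hj ▸ hmono.monotone (Nat.zero_le j)) ?_
    by_contra! hlt
    exact hmin _ hlt (hPt 0)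
  have hbetween : ∀ j k, t j < k → k < t (j + 1) → ¬ P k := by
    intro j k h1 h2 hk
    obtain ⟨l, rfl⟩ := hex k hk
    rw [hmono.lt_iff_lt] at h1 h2
    omega
  have hbound : ∀ j, t (j + 1) - t j ≤ a := by
    intro j
    obtain ⟨n, h1, h2, h3⟩ := hgap (t j) (ht0 ▸ hmono.monotone (Nat.zero_le j))
    by_contra! hlt
    exact hbetween j n h1 (by omega) h3
  have hlocate : ∀ i, a < i → ∃ j, t j < i ∧ i ≤ t (j + 1) := by
    intro i hi
    have hge : ∃ j, i ≤ t j := ⟨i, hmono.le_apply⟩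
    classical
    have h1 := Nat.find_spec hge
    have h2 : Nat.find hge ≠ 0 := by
      intro h0
      rw [h0, ht0] at h1
      omega
    obtain ⟨j, hj⟩ := Nat.exists_eq_succ_of_ne_zero h2
    exact ⟨j, not_le.1 (Nat.find_min hge (by omega)), by rw [hj] at h1; exact h1⟩
  have hbdd : BddAbove {s : ℕ | ∃ j, s = t (j + 1) - t j} :=
    ⟨a, by rintro _ ⟨j, rfl⟩; exact hbound j⟩
  have hmem := Nat.sSup_mem (s := {s : ℕ | ∃ j, s = t (j + 1) - t j}) ⟨_, 0, rfl⟩ hbdd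
  set r := sSup {s : ℕ | ∃ j, s = t (j + 1) - t j}
  have hle : ∀ j, t (j + 1) - t j ≤ r := fun j => le_csSup hbdd ⟨j, rfl⟩
  refine ⟨t, hmono, hrange, ht0, hbound, r, ⟨hmem, fun s hs => le_csSup hbdd hs⟩, ?_, ?_, ?_⟩
  -- An index beyond `a` outside `P` lies strictly inside a gap, whose length is then at least 2.
  · obtain ⟨i, hi, hPi⟩ := hnot
    obtain ⟨j, h1, h2⟩ := hlocate i hi
    have h3 : i ≠ t (j + 1) := fun h => hPi (h ▸ hPt _)
    have := hle j
    omega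
  · intro i hi
    obtain ⟨j, h1, h2⟩ := hlocate i hi
    have := hle j
    exact ⟨t (j + 1), hPt _, h2, by omega⟩
  · obtain ⟨j, hj⟩ := hmem
    have h0 : a ≤ t j := ht0 ▸ hmono.monotone (Nat.zero_le j)
    -- The interior of a longest gap consists of $r-1$ consecutive indices outside `P`.
    exact ⟨t j + 1, by omega, fun k h1 h2 => hbetween j k (by omega) (by omega)⟩

end ThinLie

theorem mainTheorem4 {F E M : Type*} [Field F] [Field E] [Algebra F E]
    [LieRing M] [LieAlgebra E M] [LieAlgebra F M] [IsScalarTower F E M]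
    (hFE : Module.finrank F E = 2)
    (𝓜 : ℕ → Submodule E M) (hM : ThinLie.IsMaximalClass E 𝓜)
    (X Y : M) (hX : X ∈ 𝓜 1) (hY : Y ∈ 𝓜 1) (hXY : LinearIndependent E ![X, Y])
    (L : LieSubalgebra F M) (hL : L = LieSubalgebra.lieSpan F M {X, Y})
    (hd : ¬ ∃ c : ℕ, ∀ i, 2 ≤ i → ThinLie.centralizerDim F 𝓜 L i = c) :
    -- `t j` is the `(j + 1)`-st element of `D₀`, which is thus infinite
    ∃ t : ℕ → ℕ, StrictMono t ∧
      Set.range t = {i : ℕ | 2 ≤ i ∧ ThinLie.centralizerDim F 𝓜 L i = 0} ∧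
      (∀ j, t (j + 1) - t j ≤ t 0) ∧
      (∃ r : ℕ, IsGreatest {s : ℕ | ∃ j, s = t (j + 1) - t j} r ∧
        2 ≤ r ∧ r ≤ t 0 ∧
        ThinLie.IsIdeallyConstrained F (ThinLie.component F 𝓜 L) r ∧
        ¬ ThinLie.IsIdeallyConstrained F (ThinLie.component F 𝓜 L) (r - 1)) ∧
      (∀ i, 2 ≤ i → i ≤ t 0 → Module.finrank F (ThinLie.component F 𝓜 L i) = 1) ∧
      (∀ i, 1 ≤ i → ¬ (2 ≤ i ∧ i ≤ t 0) →
        Module.finrank F (ThinLie.component F 𝓜 L i) = 2) := by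
  have hXL : X ∈ L := hL ▸ LieSubalgebra.subset_lieSpan (by simp)
  have hYL : Y ∈ L := hL ▸ LieSubalgebra.subset_lieSpan (by simp)
  have h := ThinLie.isTwoGenerated_component hFE hM hX hY hXY hL hXL hYL
  have hcongr : ∀ m n, ThinLie.twoStepCentralizer E 𝓜 m = ThinLie.twoStepCentralizer E 𝓜 n →
      ThinLie.centralizerDim F 𝓜 L m = ThinLie.centralizerDim F 𝓜 L n := fun m n hmn => by
    rw [ThinLie.centralizerDim, ThinLie.centralizerDim, hmn]
  have hzero : ∃ i, 2 ≤ i ∧ ThinLie.centralizerDim F 𝓜 L i = 0 := by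
    by_contra! hne
    refine hd ⟨1, fun i hi => ?_⟩
    have h1 := h.le_one i hi
    have h2 := hne i hi
    omega
  obtain ⟨a, ⟨ha2, hda⟩, hmin⟩ : ∃ a, (2 ≤ a ∧ ThinLie.centralizerDim F 𝓜 L a = 0) ∧
      ∀ k < a, ¬ (2 ≤ k ∧ ThinLie.centralizerDim F 𝓜 L k = 0) := by
    classical
    exact ⟨Nat.find hzero, Nat.find_spec hzero, fun k hk => Nat.find_min hzero hk⟩
  have hmin' : ∀ k, 2 ≤ k → k < a → ThinLie.centralizerDim F 𝓜 L k ≠ 0 :=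
    fun k hk hka h0 => hmin k hka ⟨hk, h0⟩
  -- An index with $d_i\ne 0$ may precede `a`; recurrence of its own centraliser supplies one beyond
  -- `a`.
  have hnot : ∃ i, a < i ∧ ¬ (2 ≤ i ∧ ThinLie.centralizerDim F 𝓜 L i = 0) := by
    obtain ⟨i, hi, hdi⟩ : ∃ i, 2 ≤ i ∧ ThinLie.centralizerDim F 𝓜 L i ≠ 0 := by
      by_contra! hne
      exact hd ⟨0, hne⟩
    rcases le_or_gt i a with hia | hia
    · obtain ⟨n, h1, -, h2⟩ := hM.exists_twoStepCentralizer_eq hi hia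
      exact ⟨n, h1, fun h3 => hdi (hcongr n i h2 ▸ h3.2)⟩
    · exact ⟨i, hia, fun h3 => hdi h3.2⟩
  obtain ⟨t, hmono, hrange, ht0, hbound, r, hr, hr2, hrgap, i, hai, hi⟩ :=
    ThinLie.exists_strictMono_enumeration
      (P := fun i => 2 ≤ i ∧ ThinLie.centralizerDim F 𝓜 L i = 0) ⟨ha2, hda⟩ hmin
      (fun m hm => by
        obtain ⟨n, h1, h2, h3⟩ := hM.exists_twoStepCentralizer_eq ha2 hm
        exact ⟨n, h1, h2, by omega, (hcongr n a h3).trans hda⟩) hnot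
  refine ⟨t, hmono, hrange, fun j => ht0 ▸ hbound j, ⟨r, hr, hr2, ?_, ?_, ?_⟩, ?_, ?_⟩
  · obtain ⟨j, rfl⟩ := hr.1
    exact ht0 ▸ hbound j
  · refine h.isIdeallyConstrained hmin' ha2 (by omega) fun i hi => ?_
    obtain ⟨s, h1, h2, h3⟩ := hrgap i hi
    exact ⟨s, h1.2, h2, h3⟩
  -- Both $i$ and $i+(r-1)$ exceed $t_1$, where components have dimension 2.
  · refine h.not_isIdeallyConstrained (i := i) (by omega)
      (fun k h1 h2 h3 => hi k h1 h2 ⟨by omega, h3⟩) ?_ ?_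
    · exact (h.finrank_eq_two ha2 hda hmin' hai).ge
    · exact (h.finrank_eq_two ha2 hda hmin' (by omega)).ge
  · exact fun n hn hnt => h.finrank_eq_one hmin' hn (ht0 ▸ hnt)
  · intro n hn hnt
    rcases eq_or_ne n 1 with rfl | hn1
    · exact h.finrank_one
    · exact h.finrank_eq_two ha2 hda hmin' (by omega)
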